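/- Let $s\ge 2$ be an integer, let $z_1,\dots,z_s\in\mathbb{R}^2$, and let $T_i(x)=\frac1s x+z_i$ for $i=1,\dots,s$ (homotheties with equal contraction ratios $1/s$). Let $\mathcal{J}\subset\mathbb{R}^2$ be the associated self-similar set, i.e. the unique non-empty compact set with $\mathcal{J}=\bigcup_{i=1}^s T_i(\mathcal{J})$, and assume the Open Set Condition: there is a non-empty open set $O\subset\mathbb{R}^2$ such that $\bigcup_{i=1}^s T_i(O)\subset O$ and the sets $T_i(O)$ are pairwise disjoint. Let $\mathcal{J}_0$ be the convex hull of $\mathcal{J}$ and $\mathcal{J}_{n+1}=\bigcup_{i=1}^s T_i(\mathcal{J}_n)$ for $n\geq 0$. For $a\in\mathbb{R}^2$ and $S\subset\mathbb{R}^2$ let $$\operatorname{vis}(a;S)=\frac1{2\pi}\left|\left\{\tfrac{x-a}{|x-a|}: x\in S,\ x\neq a\right\}\right|,$$ where $|\cdot|$ is arc length on the unit circle, and let $$\operatorname{Fav}(S)=\frac1\pi\int_0^\pi|\pi_\theta(S)|\,d\theta,\qquad \pi_\theta(x,y)=x\cos\theta+y\sin\theta,$$ where $|\cdot|$ is Lebesgue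 measure on $\mathbb{R}$. Then for every $a\notin\mathcal{J}$ there are constants $C_1,C_2>0$ (depending on $a$ and on $\mathcal{J}$) such that for all integers $n\ge1$ $$\operatorname{vis}(a;\mathcal{J}_n)\le C_1\sqrt{\operatorname{Fav}\bigl(\mathcal{J}_{\lfloor C_2\log n\rfloor}\bigr)}.$$ Moreover, for every compact set $F\subset\mathbb{R}^2$ disjoint from $\mathcal{J}$, the constants $C_1,C_2>0$ can be chosen so that this inequality holds for all $a\in F$ and all $n\geq 1$ simultaneously. -/

import Mathlib

open Real Set MeasureTheory

noncomputable section

namespace Visibility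

/-- The Euclidean plane. -/
abbrev Plane : Type := EuclideanSpace ℝ (Fin 2)

/-- The radial projection from `a`, of interest at points `x ≠ a`. -/
def radialProj (a x : Plane) : Plane := ‖x - a‖⁻¹ • (x - a)

/-- The visibility of `S` from `a`: the arc length of `P_a(S)`, the radial projection of `S`
(minus `a`, where the projection is undefined), divided by `2π`. The unit circle is parametrized by
angles in `[0, 2π)`. -/
def vis (a : Plane) (S : Set Plane) : ℝ :=
  1 / (2 * π) *
    volume.real {θ : ℝ | θ ∈ Ico 0 (2 * π) ∧ !₂[cos θ, sin θ] ∈ radialProj a '' (S \ {a})}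

/-- The linear projection `π_θ(x, y) = x cos θ + y sin θ`. -/
def linProj (θ : ℝ) (x : Plane) : ℝ := x 0 * cos θ + x 1 * sin θ

/-- The Favard length: the average over directions of the length of the linear projections. -/
def Fav (S : Set Plane) : ℝ := 1 / π * ∫ θ in (0 : ℝ)..π, volume.real (linProj θ '' S)

/-- The homothety `T_i(x) = x / s + z_i`, where `s` is the number of maps. -/
def homothety {s : ℕ} (z : Fin s → Plane) (i : Fin s) (x : Plane) : Plane :=
  (1 / (s : ℝ)) • x + z i

/-- `J` is the self-similar set of the maps `T_i`: the nonempty compact `J` with `J = ⋃ T_i(J)`. -/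
structure IsSelfSimilarSet {s : ℕ} (z : Fin s → Plane) (J : Set Plane) : Prop where
  nonempty : J.Nonempty
  isCompact : IsCompact J
  eq_iUnion : J = ⋃ i, homothety z i '' J

/-- The Open Set Condition for the maps `T_i`. -/
def OpenSetCondition {s : ℕ} (z : Fin s → Plane) : Prop :=
  ∃ O : Set Plane, IsOpen O ∧ O.Nonempty ∧ (⋃ i, homothety z i '' O) ⊆ O ∧
    ∀ i j, i ≠ j → Disjoint (homothety z i '' O) (homothety z j '' O)

/-- The partially constructed fractals: `J_0` is the convex hull of `J`, and
`J_{n+1} = ⋃ T_i(J_n)`. -/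
def stage {s : ℕ} (z : Fin s → Plane) (J : Set Plane) : ℕ → Set Plane
  | 0 => convexHull ℝ J
  | n + 1 => ⋃ i, homothety z i '' stage z J n

end Visibility

end

namespace Visibility

/-! Split `n = k + m` with `m = ⌊(1/3) log n⌋`, so that `J_n` consists of `s ^ k` copies of `J_m` of
ratio `ρ = s ^ (-k)`. A copy at distance at least `d` from `a`, seen in a direction `φ₀`, is so
small that radial projection is nearly linear projection orthogonal to `φ₀`. It therefore fills an
angle of order `ρ / d` times the length of an `O(ρ)`-thickening of that projection of `J_m`
(`volume_directions_le`). The projection is a union of `s ^ m` intervals, so thickening adds only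
`O(s ^ m * ρ) ≤ O(s ^ (-m))` when `k ≥ 2 * m`.

Directions where the projection has length at least `lam` have measure at most `2π Fav(J_m) / lam`
by Chebyshev. In the others the `s ^ k` copies together contribute `O(lam + s ^ (-m))`, as `s ^ k *
ρ = 1` (`vis_stage_add_le`). Take `lam = √Fav(J_m)`; the term `s ^ (-m)` is absorbed because
`Fav(J_m) ≥ c * s ^ (-m)` (`exists_le_fav_stage`), where the Open Set Condition serves to exclude a
one-point `J`. -/

/-! ### Linear projections and measure on the line. -/

theorem linProj_add (θ : ℝ) (x y : Plane) : linProj θ (x + y) = linProj θ x + linProj θ y := by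
  simp only [linProj, PiLp.add_apply]; ring

theorem linProj_sub (θ : ℝ) (x y : Plane) : linProj θ (x - y) = linProj θ x - linProj θ y := by
  simp only [linProj, PiLp.sub_apply]; ring

theorem linProj_smul (θ c : ℝ) (x : Plane) : linProj θ (c • x) = c * linProj θ x := by
  simp only [linProj, PiLp.smul_apply, smul_eq_mul]; ring

theorem linProj_add_pi (θ : ℝ) (x : Plane) : linProj (θ + π) x = -linProj θ x := by
  simp only [linProj, cos_add_pi, sin_add_pi]; ring

theorem abs_linProj_le (θ : ℝ) (x : Plane) : |linProj θ x| ≤ ‖x‖ := by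
  rw [EuclideanSpace.norm_eq]
  apply Real.abs_le_sqrt
  simp only [linProj, Fin.sum_univ_two, Real.norm_eq_abs, sq_abs]
  nlinarith [sq_nonneg (x 0 * sin θ - x 1 * cos θ), sin_sq_add_cos_sq θ]

theorem continuous_linProj : Continuous (fun p : ℝ × Plane => linProj p.1 p.2) := by
  unfold linProj; fun_prop

theorem linProj_image_eq (θ : ℝ) (S : Set Plane) :
    linProj (θ + π) '' S = -(linProj θ '' S) := by
  ext t
  simp only [mem_image, Set.mem_neg, linProj_add_pi, neg_eq_iff_eq_neg]

theorem volume_linProj_periodic (S : Set Plane) :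
    Function.Periodic (fun θ => volume.real (linProj θ '' S)) π := by
  intro θ
  simp only [linProj_image_eq, Measure.real, Measure.measure_neg]

/-- `arctan` is `1`-Lipschitz. -/
theorem lipschitzWith_arctan : LipschitzWith 1 arctan := by
  apply lipschitzWith_of_nnnorm_deriv_le differentiable_arctan
  intro x
  rw [Real.deriv_arctan, ← NNReal.coe_le_coe, coe_nnnorm, Real.norm_eq_abs, NNReal.coe_one,
    abs_of_nonneg (by positivity)]
  rw [div_le_one (by positivity)]
  nlinarith [sq_nonneg x]

/-- The map is `α`-Lipschitz; comparing Hausdorff measures requires no measurability of `A`. -/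
theorem volume_image_arctan_le {α : ℝ} (hα : 0 ≤ α) (β c : ℝ) (A : Set ℝ) :
    volume ((fun t => arctan (α * t + β) + c) '' A) ≤ ENNReal.ofReal α * volume A := by
  have h : LipschitzWith (Real.toNNReal α) (fun t => arctan (α * t + β) + c) := by
    apply LipschitzWith.of_dist_le_mul
    intro x y
    have h1 := lipschitzWith_arctan.dist_le_mul (α * x + β) (α * y + β)
    rw [Real.coe_toNNReal α hα, dist_add_right]
    refine h1.trans (le_of_eq ?_)
    rw [dist_add_right, NNReal.coe_one, one_mul, Real.dist_eq, Real.dist_eq, ← mul_sub, abs_mul,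
      abs_of_nonneg hα]
  have h2 := h.hausdorffMeasure_image_le (d := 1) zero_le_one A
  rw [hausdorffMeasure_real, ENNReal.rpow_one] at h2
  exact h2

theorem volume_thickening_iUnion_Icc_le {ι : Type*} [Fintype ι] (a b : ι → ℝ)
    {ε : ℝ} (hε : 0 ≤ ε) :
    volume {t : ℝ | ∃ y ∈ ⋃ i, Icc (a i) (b i), |t - y| ≤ ε} ≤
      volume (⋃ i, Icc (a i) (b i)) + ENNReal.ofReal (Fintype.card ι * (2 * ε)) := by
  have hsub : {t : ℝ | ∃ y ∈ ⋃ i, Icc (a i) (b i), |t - y| ≤ ε} ⊆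
      (⋃ i, Icc (a i) (b i)) ∪ ⋃ i, (Icc (a i - ε) (a i) ∪ Icc (b i) (b i + ε)) := by
    rintro t ⟨y, hy, hty⟩
    obtain ⟨i, hi⟩ := mem_iUnion.1 hy
    rw [abs_le] at hty
    by_cases h1 : t < a i
    · exact Or.inr (mem_iUnion.2 ⟨i, Or.inl ⟨by linarith [hi.1], h1.le⟩⟩)
    by_cases h2 : b i < t
    · exact Or.inr (mem_iUnion.2 ⟨i, Or.inr ⟨h2.le, by linarith [hi.2]⟩⟩)
    · exact Or.inl (mem_iUnion.2 ⟨i, not_lt.1 h1, not_lt.1 h2⟩)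
  refine (measure_mono hsub).trans ((measure_union_le _ _).trans ?_)
  gcongr
  refine (measure_iUnion_le _).trans ?_
  rw [tsum_fintype]
  have : ∀ i, volume (Icc (a i - ε) (a i) ∪ Icc (b i) (b i + ε)) ≤ ENNReal.ofReal (2 * ε) := by
    intro i
    refine (measure_union_le _ _).trans ?_
    rw [Real.volume_Icc, Real.volume_Icc, ← ENNReal.ofReal_add (by linarith) (by linarith)]
    apply ENNReal.ofReal_le_ofReal; linarith
  refine (Finset.sum_le_sum fun i _ => this i).trans ?_
  rw [Finset.sum_const, Finset.card_univ, nsmul_eq_mul,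
    ENNReal.ofReal_mul (p := (Fintype.card ι : ℝ)) (by positivity), ENNReal.ofReal_natCast]

/-! ### Stages as unions of small copies, and their projections. -/

/-- `b w` is the translation part of the composition of maps along the word `w`. The second clause
puts a point of `J` near each copy, which keeps the copies away from `a`. -/
theorem exists_translations {s : ℕ} (z : Fin s → Plane) (k : ℕ) :
    ∃ b : (Fin k → Fin s) → Plane,
      (∀ J m, stage z J (k + m) = ⋃ w, (fun x => (1 / (s : ℝ)) ^ k • x + b w) '' stage z J m) ∧
      ∀ J, IsSelfSimilarSet z J → ∀ w, ∀ x ∈ J, (1 / (s : ℝ)) ^ k • x + b w ∈ J := by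
  induction k with
  | zero =>
    refine ⟨fun _ => 0, fun J m => ?_, fun J _ _ x hx => by simpa using hx⟩
    simpa using (iUnion_const _).symm
  | succ k ih =>
    obtain ⟨b, hb, hb'⟩ := ih
    have key : ∀ (i : Fin s) (w : Fin k → Fin s) (x : Plane),
        (1 / (s : ℝ)) ^ (k + 1) • x + ((1 / (s : ℝ)) • b w + z i) =
          homothety z i ((1 / (s : ℝ)) ^ k • x + b w) := by
      intro i w x
      simp only [homothety, pow_succ', mul_smul, smul_add, add_assoc]
    refine ⟨fun w => (1 / (s : ℝ)) • b (Fin.tail w) + z (w 0), fun J m => ?_,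
      fun J hJ w x hx => ?_⟩
    · rw [show k + 1 + m = (k + m) + 1 by omega, stage, hb]
      ext y
      simp only [mem_iUnion, mem_image, key]
      constructor
      · rintro ⟨i, _, ⟨w, x, hx, rfl⟩, rfl⟩
        exact ⟨Fin.cons i w, x, hx, by simp⟩
      · rintro ⟨w, x, hx, rfl⟩
        exact ⟨w 0, _, ⟨Fin.tail w, x, hx, rfl⟩, rfl⟩
    · rw [key, hJ.eq_iUnion]
      exact mem_iUnion.2 ⟨_, mem_image_of_mem _ (hb' J hJ _ x hx)⟩

theorem stage_subset_convexHull {s : ℕ} {z : Fin s → Plane} {J : Set Plane}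
    (hJ : IsSelfSimilarSet z J) (m : ℕ) : stage z J m ⊆ convexHull ℝ J := by
  obtain ⟨b, hb, hb'⟩ := exists_translations z m
  rw [show m = m + 0 from rfl, hb]
  refine iUnion_subset fun w => ?_
  rw [image_subset_iff]
  refine convexHull_min (fun x hx => subset_convexHull ℝ J (hb' J hJ w x hx)) ?_
  have h := (convex_convexHull ℝ J).affine_preimage
    (((1 / (s : ℝ)) ^ m • (LinearMap.id : Plane →ₗ[ℝ] Plane)).toAffineMap +
      AffineMap.const ℝ Plane (b w))
  exact h

theorem convexHull_eq_Icc {K : Set ℝ} (hK : IsCompact K) (hne : K.Nonempty) :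
    convexHull ℝ K = Icc (sInf K) (sSup K) := by
  apply subset_antisymm
  · exact convexHull_min (fun x hx => ⟨csInf_le hK.bddBelow hx, le_csSup hK.bddAbove hx⟩)
      (convex_Icc _ _)
  · exact (convex_convexHull ℝ K).ordConnected.out (subset_convexHull ℝ K (hK.sInf_mem hne))
      (subset_convexHull ℝ K (hK.sSup_mem hne))

theorem linProj_image_convexHull (θ : ℝ) {J : Set Plane} (hJ : IsCompact J) (hne : J.Nonempty) :
    linProj θ '' convexHull ℝ J = Icc (sInf (linProj θ '' J)) (sSup (linProj θ '' J)) := by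
  let L : Plane →ₗ[ℝ] ℝ :=
    { toFun := linProj θ, map_add' := linProj_add θ, map_smul' := linProj_smul θ }
  have h := L.image_convexHull J
  have hc : Continuous (linProj θ) := by unfold linProj; fun_prop
  rw [← convexHull_eq_Icc (hJ.image hc) (hne.image _)]
  exact h

/-- Each copy of the convex hull projects to one interval. The count `s ^ m` controls thickenings;
continuity of the endpoints gives measurability in `θ`. -/
theorem linProj_image_stage {s : ℕ} (hs : 2 ≤ s) {z : Fin s → Plane} {J : Set Plane}
    (hJ : IsSelfSimilarSet z J) (m : ℕ) :
    ∃ A B : (Fin m → Fin s) → ℝ → ℝ, (∀ w, Continuous (A w)) ∧ (∀ w, Continuous (B w)) ∧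
      ∀ θ, linProj θ '' stage z J m = ⋃ w, Icc (A w θ) (B w θ) := by
  obtain ⟨b, hb, -⟩ := exists_translations z m
  have hr : 0 < (1 / (s : ℝ)) ^ m := by positivity
  have hc : Continuous ↿linProj := continuous_linProj
  have hcb : ∀ w, Continuous fun θ => linProj θ (b w) := fun w => by unfold linProj; fun_prop
  refine ⟨fun w θ => (1 / (s : ℝ)) ^ m * sInf (linProj θ '' J) + linProj θ (b w),
    fun w θ => (1 / (s : ℝ)) ^ m * sSup (linProj θ '' J) + linProj θ (b w),
    fun w => ((hJ.isCompact.continuous_sInf hc).const_mul _).add (hcb w),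
    fun w => ((hJ.isCompact.continuous_sSup hc).const_mul _).add (hcb w), fun θ => ?_⟩
  rw [show stage z J m = _ from hb J 0, image_iUnion]
  refine iUnion_congr fun w => ?_
  rw [← Set.image_affine_Icc' hr, ← linProj_image_convexHull θ hJ.isCompact hJ.nonempty,
    image_image, image_image]
  simp only [linProj_add, linProj_smul, stage]

theorem measurable_volume_linProj {s : ℕ} (hs : 2 ≤ s) {z : Fin s → Plane} {J : Set Plane}
    (hJ : IsSelfSimilarSet z J) (m : ℕ) :
    Measurable fun θ => volume.real (linProj θ '' stage z J m) := by
  obtain ⟨A, B, hA, hB, h⟩ := linProj_image_stage hs hJ m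
  have hm : MeasurableSet (⋃ w, {p : ℝ × ℝ | A w p.1 ≤ p.2 ∧ p.2 ≤ B w p.1}) := by
    refine MeasurableSet.iUnion fun w => IsClosed.measurableSet ?_
    exact (isClosed_le ((hA w).comp continuous_fst) continuous_snd).inter
      (isClosed_le continuous_snd ((hB w).comp continuous_fst))
  have h2 := (measurable_measure_prodMk_left (ν := (volume : Measure ℝ)) hm).ennreal_toReal
  have e : ∀ θ, linProj θ '' stage z J m =
      Prod.mk θ ⁻¹' (⋃ w, {p : ℝ × ℝ | A w p.1 ≤ p.2 ∧ p.2 ≤ B w p.1}) := by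
    intro θ
    rw [h, preimage_iUnion]
    rfl
  simpa only [Measure.real, e] using h2

/-! ### Directions in which one copy is seen. -/

theorem exists_polar_of_mem_radialProj {a : Plane} {S : Set Plane} {φ : ℝ}
    (h : !₂[cos φ, sin φ] ∈ radialProj a '' (S \ {a})) :
    ∃ x ∈ S, ∀ θ, linProj θ (x - a) = ‖x - a‖ * cos (φ - θ) := by
  obtain ⟨x, ⟨hx, hxa⟩, he⟩ := h
  have hr : ‖x - a‖ ≠ 0 := by
    rw [norm_ne_zero_iff, sub_ne_zero]; exact hxa
  refine ⟨x, hx, fun θ => ?_⟩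
  have h2 : x - a = ‖x - a‖ • !₂[cos φ, sin φ] := by
    rw [← he, radialProj, smul_smul, mul_inv_cancel₀ hr, one_smul]
  conv_lhs => rw [h2]
  rw [linProj_smul, cos_sub]
  simp [linProj]

/-- As `φ - φ₀` lies in `(-2π, 2π)`, a positive cosine leaves three arcs, hence three branches of
the arctangent and the factor `3` in `volume_directions_le`. -/
theorem exists_eq_arctan_of_cos_pos {φ φ₀ : ℝ} (h : φ ∈ Ico 0 (2 * π)) (h₀ : φ₀ ∈ Ico 0 (2 * π))
    (hc : 0 < cos (φ - φ₀)) :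
    φ = arctan (tan (φ - φ₀)) + φ₀ ∨ φ = arctan (tan (φ - φ₀)) + (φ₀ + 2 * π) ∨
      φ = arctan (tan (φ - φ₀)) + (φ₀ - 2 * π) := by
  have hπ := pi_pos
  obtain ⟨h1, h2⟩ := h
  obtain ⟨h3, h4⟩ := h₀
  rcases lt_or_ge (φ - φ₀) (-(π / 2)) with hl | hl
  · right; right
    have : φ - φ₀ < -(π + π / 2) := by
      by_contra hcon
      have := cos_nonpos_of_pi_div_two_le_of_le (x := -(φ - φ₀)) (by linarith) (by linarith)
      rw [cos_neg] at this
      linarith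
    rw [← tan_add_pi, ← tan_add_pi, arctan_tan (by linarith) (by linarith)]
    ring
  rcases lt_or_ge (π / 2) (φ - φ₀) with hg | hg
  · right; left
    have : π + π / 2 < φ - φ₀ := by
      by_contra hcon
      have := cos_nonpos_of_pi_div_two_le_of_le (x := φ - φ₀) (by linarith) (by linarith)
      linarith
    rw [← tan_sub_pi, ← tan_sub_pi, arctan_tan (by linarith) (by linarith)]
    ring
  · left
    have hne : φ - φ₀ ≠ -(π / 2) := by
      intro he; rw [he, cos_neg, cos_pi_div_two] at hc; exact lt_irrefl _ hc
    have hne' : φ - φ₀ ≠ π / 2 := by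
      intro he; rw [he, cos_pi_div_two] at hc; exact lt_irrefl _ hc
    rw [arctan_tan (lt_of_le_of_ne hl hne.symm) (lt_of_le_of_ne hg hne')]
    ring

/-- The directions in which a small far away copy `ρ S + b` of `S` is seen from `a` are controlled
by the linear projection of `S` in one of these directions. -/
theorem volume_directions_le {a b : Plane} {S : Set Plane} {ρ M d φ₀ : ℝ} (hρ : 0 < ρ)
    (hd : 0 < d) (hM : ∀ x ∈ S, ∀ y ∈ S, ‖x - y‖ ≤ M) (hdist : ∀ x ∈ S, d ≤ ‖ρ • x + b - a‖)
    (hsmall : 2 * (ρ * M) ≤ d) (h₀ : φ₀ ∈ Ico 0 (2 * π))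
    (hφ₀ : !₂[cos φ₀, sin φ₀] ∈ radialProj a '' (((fun x => ρ • x + b) '' S) \ {a})) :
    volume {φ : ℝ | φ ∈ Ico 0 (2 * π) ∧
      !₂[cos φ, sin φ] ∈ radialProj a '' (((fun x => ρ • x + b) '' S) \ {a})} ≤
      3 * (ENNReal.ofReal (ρ / d) *
        volume {t : ℝ | ∃ y ∈ linProj (φ₀ + π / 2) '' S, |t - y| ≤ 2 * ρ * M ^ 2 / d}) := by
  obtain ⟨_, ⟨x₀, hx₀, rfl⟩, hp₀⟩ := exists_polar_of_mem_radialProj hφ₀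
  set D := ‖ρ • x₀ + b - a‖
  have hdD : d ≤ D := hdist x₀ hx₀
  have hD0 : 0 < D := hd.trans_le hdD
  set A : Set ℝ := {t : ℝ | ∃ y ∈ linProj (φ₀ + π / 2) '' S, |t - y| ≤ 2 * ρ * M ^ 2 / d}
  set β := -(ρ / D * linProj (φ₀ + π / 2) x₀) with hβ
  have hM0 : 0 ≤ M := by simpa using hM x₀ hx₀ x₀ hx₀
  let f : ℝ → ℝ → ℝ := fun c t => arctan (ρ / D * t + β) + c
  have hsub : {φ : ℝ | φ ∈ Ico 0 (2 * π) ∧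
      !₂[cos φ, sin φ] ∈ radialProj a '' (((fun x => ρ • x + b) '' S) \ {a})} ⊆
      f φ₀ '' A ∪ (f (φ₀ + 2 * π) '' A ∪ f (φ₀ - 2 * π) '' A) := by
    rintro φ ⟨hφ, hx⟩
    obtain ⟨_, ⟨x, hx, rfl⟩, hp⟩ := exists_polar_of_mem_radialProj hx
    simp only at hp hp₀
    have hxx : ρ • x + b - a = ρ • (x - x₀) + (ρ • x₀ + b - a) := by
      rw [smul_sub]; abel
    have hn : ‖ρ • (x - x₀)‖ ≤ ρ * M := by
      rw [norm_smul, Real.norm_eq_abs, abs_of_pos hρ]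
      exact mul_le_mul_of_nonneg_left (hM x hx x₀ hx₀) hρ.le
    -- the components of the point along and across the direction `φ₀`
    have hq := hp φ₀
    have hq' := hp (φ₀ + π / 2)
    have e1 := hp₀ φ₀
    have e2 := hp₀ (φ₀ + π / 2)
    rw [sub_self, cos_zero, mul_one] at e1
    rw [show φ₀ - (φ₀ + π / 2) = -(π / 2) by ring, cos_neg, cos_pi_div_two, mul_zero] at e2
    rw [show φ - (φ₀ + π / 2) = (φ - φ₀) - π / 2 by ring, cos_sub_pi_div_two] at hq'
    have b1 := (abs_linProj_le φ₀ (ρ • (x - x₀))).trans hn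
    have b2 := (abs_linProj_le (φ₀ + π / 2) (ρ • (x - x₀))).trans hn
    rw [hxx, linProj_add, e1] at hq
    rw [hxx, linProj_add, e2, add_zero] at hq'
    rw [← hxx] at hq hq'
    set r := ‖ρ • x + b - a‖
    set u := linProj φ₀ (ρ • (x - x₀))
    set p := linProj (φ₀ + π / 2) (ρ • (x - x₀)) with hpdef
    -- `hsmall` gives `|u| ≤ D / 2`: the copy stays in front of `a`.
    have hq2 : D / 2 ≤ u + D := by linarith [(abs_le.1 b1).1]
    have hq0 : 0 < u + D := by linarith
    have hr0 : 0 ≤ r := norm_nonneg _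
    have hc : 0 < cos (φ - φ₀) := by
      by_contra hcon
      have := mul_nonpos_of_nonneg_of_nonpos hr0 (not_lt.1 hcon)
      linarith
    have hrpos : r ≠ 0 := by
      intro h0; rw [h0, zero_mul] at hq; linarith
    have htan : tan (φ - φ₀) = p / (u + D) := by
      rw [hq, hq', tan_eq_sin_div_cos, mul_div_mul_left _ _ hrpos]
    have hp' : p = ρ * (linProj (φ₀ + π / 2) x - linProj (φ₀ + π / 2) x₀) := by
      rw [hpdef, linProj_smul, linProj_sub]
    -- the parameter of the angle `φ`
    let t := D / ρ * (p / (u + D)) + linProj (φ₀ + π / 2) x₀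
    have htA : t ∈ A := by
      refine ⟨linProj (φ₀ + π / 2) x, mem_image_of_mem _ hx, ?_⟩
      -- `t` makes the argument of the arctangent equal to `tan (φ - φ₀) = p / (u + D)`. Its error
      -- comes from replacing `u + D` by `D`, and is of second order since `p` and `u` are both at
      -- most `ρ * M` in absolute value.
      have e : t - linProj (φ₀ + π / 2) x = -(p * u / (ρ * (u + D))) := by
        have : linProj (φ₀ + π / 2) x = p / ρ + linProj (φ₀ + π / 2) x₀ := by
          rw [hp']; field_simp; ring
        simp only [t]
        rw [this]; field_simp; ring
      rw [e, abs_neg, abs_div, abs_mul, abs_of_pos (mul_pos hρ hq0)]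
      calc |p| * |u| / (ρ * (u + D)) ≤ (ρ * M) * (ρ * M) / (ρ * (d / 2)) := by
            have : d / 2 ≤ u + D := by linarith
            gcongr
        _ = 2 * ρ * M ^ 2 / d := by field_simp
    have hft : ∀ c, f c t = arctan (tan (φ - φ₀)) + c := by
      intro c
      simp only [f, t, hβ, htan]
      congr 2
      field_simp
      ring
    rcases exists_eq_arctan_of_cos_pos hφ h₀ hc with h | h | h
    · exact Or.inl ⟨t, htA, by rw [hft]; exact h.symm⟩
    · exact Or.inr (Or.inl ⟨t, htA, by rw [hft]; exact h.symm⟩)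
    · exact Or.inr (Or.inr ⟨t, htA, by rw [hft]; exact h.symm⟩)
  have hf : ∀ c, volume (f c '' A) ≤ ENNReal.ofReal (ρ / d) * volume A := fun c => by
    refine (volume_image_arctan_le (by positivity) β c A).trans ?_
    gcongr
  refine (measure_mono hsub).trans ((measure_union_le _ _).trans ?_)
  refine (add_le_add (hf _) ((measure_union_le _ _).trans (add_le_add (hf _) (hf _)))).trans
    (le_of_eq ?_)
  ring

/-! ### Integrability and lower bounds for the Favard length. -/

variable {s : ℕ} {z : Fin s → Plane} {J : Set Plane}

theorem IsSelfSimilarSet.exists_norm_le (hJ : IsSelfSimilarSet z J) :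
    ∃ R > 0, ∀ x ∈ convexHull ℝ J, ‖x‖ ≤ R := by
  obtain ⟨R, hR, h⟩ := (isBounded_convexHull.2 hJ.isCompact.isBounded).exists_pos_norm_le
  exact ⟨R, hR, h⟩

theorem volume_linProj_ne_top (hJ : IsSelfSimilarSet z J) (m : ℕ) (θ : ℝ) :
    volume (linProj θ '' stage z J m) ≠ ⊤ := by
  obtain ⟨R, hR, h⟩ := hJ.exists_norm_le
  refine ((measure_mono ?_).trans_lt (measure_Icc_lt_top (a := -R) (b := R))).ne
  rintro _ ⟨x, hx, rfl⟩
  exact abs_le.1 ((abs_linProj_le θ x).trans (h x (stage_subset_convexHull hJ m hx)))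

theorem intervalIntegrable_volume_linProj (hs : 2 ≤ s) (hJ : IsSelfSimilarSet z J) (m : ℕ)
    (u v : ℝ) :
    IntervalIntegrable (fun θ => volume.real (linProj θ '' stage z J m)) volume u v := by
  obtain ⟨R, hR, h⟩ := hJ.exists_norm_le
  refine IntervalIntegrable.mono_fun' (intervalIntegrable_const (c := 2 * R))
    (measurable_volume_linProj hs hJ m).aestronglyMeasurable (ae_of_all _ fun θ => ?_)
  have hsub : linProj θ '' stage z J m ⊆ Icc (-R) R := by
    rintro _ ⟨x, hx, rfl⟩
    exact abs_le.1 ((abs_linProj_le θ x).trans (h x (stage_subset_convexHull hJ m hx)))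
  have h2 := measureReal_mono (μ := volume) hsub measure_Icc_lt_top.ne
  rw [Real.volume_real_Icc_of_le (by linarith)] at h2
  simp only [Real.norm_eq_abs, abs_of_nonneg measureReal_nonneg]
  linarith

theorem integral_volume_linProj (hs : 2 ≤ s) (hJ : IsSelfSimilarSet z J) (m : ℕ) :
    ∫ φ in (0 : ℝ)..2 * π, volume.real (linProj (φ + π / 2) '' stage z J m) =
      2 * π * Fav (stage z J m) := by
  have hper := volume_linProj_periodic (stage z J m)
  have hI := intervalIntegrable_volume_linProj hs hJ m
  rw [intervalIntegral.integral_comp_add_right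
    (fun θ => volume.real (linProj θ '' stage z J m)), zero_add, Fav,
    ← intervalIntegral.integral_add_adjacent_intervals (hI (π / 2) (π / 2 + π))
      (hI (π / 2 + π) (2 * π + π / 2)),
    show 2 * π + π / 2 = π / 2 + π + π by ring, hper.intervalIntegral_add_eq (π / 2) 0,
    hper.intervalIntegral_add_eq (π / 2 + π) 0, zero_add]
  field_simp
  ring

/-- A one-point `J` would be fixed by all the maps; having equal ratios, they would coincide,
against disjointness of the images of `O`. -/
theorem exists_ne_of_openSetCondition (hs : 2 ≤ s) (hJ : IsSelfSimilarSet z J)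
    (hO : OpenSetCondition z) : ∃ x ∈ J, ∃ y ∈ J, x ≠ y := by
  by_contra! hcon
  obtain ⟨p, hp⟩ := hJ.nonempty
  have hfix : ∀ i, homothety z i p = p := fun i => by
    refine hcon _ ?_ _ hp
    rw [hJ.eq_iUnion]
    exact mem_iUnion.2 ⟨i, mem_image_of_mem _ hp⟩
  obtain ⟨O, -, ⟨o, ho⟩, -, hdisj⟩ := hO
  let i₀ : Fin s := ⟨0, by omega⟩
  let i₁ : Fin s := ⟨1, by omega⟩
  have hz : z i₀ = z i₁ := add_left_cancel ((hfix i₀).trans (hfix i₁).symm)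
  have h := hdisj i₀ i₁ (by simp [i₀, i₁])
  refine Set.disjoint_left.1 h (mem_image_of_mem _ ho) ⟨o, ho, ?_⟩
  simp only [homothety, hz]

theorem integral_abs_linProj_pos {u : Plane} (hu : u ≠ 0) :
    0 < ∫ θ in (0 : ℝ)..π, |linProj θ u| := by
  refine intervalIntegral.integral_pos pi_pos ?_ (fun _ _ => abs_nonneg _) ?_
  · unfold linProj; fun_prop
  · by_cases h0 : u 0 = 0
    · refine ⟨π / 2, ⟨by positivity, by linarith [pi_pos]⟩, abs_pos.2 ?_⟩
      simp only [linProj, cos_pi_div_two, sin_pi_div_two, mul_zero, zero_add, mul_one]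
      intro h1
      apply hu
      ext i
      fin_cases i
      · exact h0
      · exact h1
    · refine ⟨0, ⟨le_rfl, pi_pos.le⟩, abs_pos.2 ?_⟩
      simpa [linProj] using h0

/-- A single copy of the convex hull already contains a segment of length `s ^ (-m) * ‖x - y‖`, for
distinct `x, y ∈ J`. -/
theorem exists_le_fav_stage (hs : 2 ≤ s) (hJ : IsSelfSimilarSet z J) (hO : OpenSetCondition z) :
    ∃ c > 0, ∀ m, c * (1 / (s : ℝ)) ^ m ≤ Fav (stage z J m) := by
  obtain ⟨x, hx, y, hy, hxy⟩ := exists_ne_of_openSetCondition hs hJ hO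
  refine ⟨1 / π * ∫ θ in (0 : ℝ)..π, |linProj θ (x - y)|,
    mul_pos (by positivity) (integral_abs_linProj_pos (sub_ne_zero.2 hxy)), fun m => ?_⟩
  obtain ⟨b, hb, -⟩ := exists_translations z m
  have hpt : ∀ θ, (1 / (s : ℝ)) ^ m * |linProj θ (x - y)| ≤
      volume.real (linProj θ '' stage z J m) := by
    intro θ
    let w : Fin m → Fin s := fun _ => ⟨0, by omega⟩
    set ρ := (1 / (s : ℝ)) ^ m
    have hρ : 0 < ρ := by positivity
    have hsub : uIcc (linProj θ (ρ • x + b w)) (linProj θ (ρ • y + b w)) ⊆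
        linProj θ '' stage z J m := by
      have e : linProj θ '' ((fun x => ρ • x + b w) '' convexHull ℝ J) =
          Icc (ρ * sInf (linProj θ '' J) + linProj θ (b w))
            (ρ * sSup (linProj θ '' J) + linProj θ (b w)) := by
        rw [← Set.image_affine_Icc' hρ,
          ← linProj_image_convexHull θ hJ.isCompact hJ.nonempty, image_image, image_image]
        simp only [linProj_add, linProj_smul]
      have hsub' : linProj θ '' ((fun x => ρ • x + b w) '' convexHull ℝ J) ⊆
          linProj θ '' stage z J m := by
        rw [show stage z J m = _ from hb J 0]
        exact image_mono (subset_iUnion (fun w => (fun x => ρ • x + b w) '' stage z J 0) w)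
      refine subset_trans ?_ hsub'
      rw [e]
      apply ordConnected_Icc.uIcc_subset <;> rw [← e]
      · exact mem_image_of_mem _ (mem_image_of_mem _ (subset_convexHull ℝ J hx))
      · exact mem_image_of_mem _ (mem_image_of_mem _ (subset_convexHull ℝ J hy))
    have h := measureReal_mono (μ := volume) hsub (volume_linProj_ne_top hJ m θ)
    rw [Measure.real, Real.volume_interval, ENNReal.toReal_ofReal (abs_nonneg _), ← linProj_sub,
      show ρ • y + b w - (ρ • x + b w) = (-ρ) • (x - y) by rw [neg_smul, smul_sub]; abel,
      linProj_smul, abs_mul, abs_neg, abs_of_pos hρ] at h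
    exact h
  have hint : IntervalIntegrable (fun θ => |linProj θ (x - y)|) volume 0 π := by
    apply Continuous.intervalIntegrable
    unfold linProj; fun_prop
  have h := intervalIntegral.integral_mono pi_pos.le (hint.const_mul ((1 / (s : ℝ)) ^ m))
    (intervalIntegrable_volume_linProj hs hJ m 0 π) hpt
  rw [intervalIntegral.integral_const_mul] at h
  rw [Fav, mul_assoc, mul_comm (∫ _ in _..π, _)]
  gcongr

/-! ### Visibility estimates. -/

theorem vis_le_one (a : Plane) (S : Set Plane) : vis a S ≤ 1 := by
  have h : volume.real {θ : ℝ | θ ∈ Ico 0 (2 * π) ∧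
      !₂[cos θ, sin θ] ∈ radialProj a '' (S \ {a})} ≤ 2 * π := by
    refine (measureReal_mono (fun θ h => h.1) measure_Ico_lt_top.ne).trans (le_of_eq ?_)
    rw [Real.volume_real_Ico_of_le (by positivity), sub_zero]
  rw [vis, one_div, inv_mul_le_iff₀ (by positivity)]
  linarith

/-- The main estimate: seen from a distance, the pieces of generation `k` whose direction has a
small projection of `J_m` are estimated one by one, and the remaining directions by Chebyshev's
inequality. -/
theorem vis_stage_add_le (hs : 2 ≤ s) (hJ : IsSelfSimilarSet z J) {R d lam : ℝ} (hd : 0 < d)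
    (hlam : 0 < lam) (hR : ∀ x ∈ convexHull ℝ J, ‖x‖ ≤ R) {a : Plane}
    (ha : ∀ x ∈ J, 2 * d ≤ dist a x) {k m : ℕ} (hk : 4 * ((1 / (s : ℝ)) ^ k * R) ≤ d)
    (hkm : 2 * m ≤ k) :
    vis a (stage z J (k + m)) ≤
      Fav (stage z J m) / lam + 1 / d * (lam + 16 * R ^ 2 / d * (1 / (s : ℝ)) ^ m) := by
  obtain ⟨b, hb, hb'⟩ := exists_translations z k
  set ρ := (1 / (s : ℝ)) ^ k with hρdef
  have hs0 : (0 : ℝ) < s := by positivity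
  have hρ : 0 < ρ := by positivity
  obtain ⟨x₁, hx₁⟩ := hJ.nonempty
  have hR0 : 0 ≤ R := (norm_nonneg _).trans (hR x₁ (subset_convexHull ℝ J hx₁))
  set S := stage z J m
  have hSR : ∀ x ∈ S, ‖x‖ ≤ R := fun x hx => hR x (stage_subset_convexHull hJ m hx)
  have hSM : ∀ x ∈ S, ∀ y ∈ S, ‖x - y‖ ≤ 2 * R := fun x hx y hy =>
    (norm_sub_le _ _).trans (by linarith [hSR x hx, hSR y hy])
  have hdist : ∀ w, ∀ x ∈ S, d ≤ ‖ρ • x + b w - a‖ := by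
    intro w x hx
    have h1 := ha _ (hb' J hJ w x₁ hx₁)
    have h2 : ‖ρ • (x - x₁)‖ ≤ ρ * (2 * R) := by
      rw [norm_smul, Real.norm_eq_abs, abs_of_pos hρ]
      refine mul_le_mul_of_nonneg_left ((norm_sub_le _ _).trans ?_) hρ.le
      linarith [hSR x hx, hR x₁ (subset_convexHull ℝ J hx₁)]
    rw [dist_eq_norm, show a - (ρ • x₁ + b w) = ρ • (x - x₁) - (ρ • x + b w - a) by
      rw [smul_sub]; abel] at h1
    have h3 := norm_sub_le (ρ • (x - x₁)) (ρ • x + b w - a)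
    linarith
  let h : ℝ → ℝ := fun φ => volume.real (linProj (φ + π / 2) '' S)
  let V : Set Plane → Set ℝ := fun K => {φ : ℝ | φ ∈ Ico 0 (2 * π) ∧
    !₂[cos φ, sin φ] ∈ radialProj a '' (K \ {a})}
  let piece : (Fin k → Fin s) → Set Plane := fun w => (fun x => ρ • x + b w) '' S
  let bad : Set ℝ := {φ | φ ∈ Ioc 0 (2 * π) ∧ lam ≤ h φ}
  set ε := 2 * ρ * (2 * R) ^ 2 / d with hε
  have hε0 : 0 ≤ ε := by positivity
  set B := 3 * (ρ / d * (lam + (s : ℝ) ^ m * (2 * ε))) with hB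
  have hgood : ∀ w, volume (V (piece w) ∩ {φ | h φ < lam}) ≤ ENNReal.ofReal B := by
    intro w
    rcases eq_empty_or_nonempty (V (piece w) ∩ {φ | h φ < lam}) with he | ⟨φ₀, hV, hφ⟩
    · rw [he, measure_empty]; exact zero_le
    refine (measure_mono inter_subset_left).trans ((volume_directions_le hρ hd hSM (hdist w)
      (by linarith) hV.1 hV.2).trans ?_)
    obtain ⟨A, B', -, -, hAB⟩ := linProj_image_stage hs hJ m
    have h1 := volume_thickening_iUnion_Icc_le (fun w => A w (φ₀ + π / 2))
      (fun w => B' w (φ₀ + π / 2)) hε0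
    rw [← hAB] at h1
    have h2 : volume (linProj (φ₀ + π / 2) '' stage z J m) ≤ ENNReal.ofReal lam := by
      rw [← ENNReal.ofReal_toReal (volume_linProj_ne_top hJ m _)]
      exact ENNReal.ofReal_le_ofReal (le_of_lt hφ)
    have h3 := h1.trans (add_le_add_left h2 _)
    rw [Fintype.card_fun, Fintype.card_fin, Fintype.card_fin, Nat.cast_pow,
      ← ENNReal.ofReal_add hlam.le (by positivity)] at h3
    rw [hB, ENNReal.ofReal_mul (by norm_num), ENNReal.ofReal_mul (by positivity)]
    rw [show ENNReal.ofReal 3 = 3 by simp]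
    gcongr
  have hbad : volume.real bad ≤ 2 * π * Fav S / lam := by
    have hI : IntegrableOn h (Ioc 0 (2 * π)) := by
      rw [← intervalIntegrable_iff_integrableOn_Ioc_of_le (by positivity)]
      have := (intervalIntegrable_volume_linProj hs hJ m (0 + π / 2)
        (2 * π + π / 2)).comp_add_right (π / 2)
      simpa using this
    have h1 := mul_meas_ge_le_integral_of_nonneg (μ := volume.restrict (Ioc 0 (2 * π))) (f := h)
      (ae_of_all _ fun _ => measureReal_nonneg) hI lam
    rw [← intervalIntegral.integral_of_le (by positivity), integral_volume_linProj hs hJ m,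
      measureReal_restrict_apply' measurableSet_Ioc] at h1
    rw [le_div_iff₀ hlam, mul_comm]
    have e : bad = {x | lam ≤ h x} ∩ Ioc 0 (2 * π) := by
      ext φ; exact and_comm
    rw [e]
    exact h1
  -- The null set `{0}` reconciles `Ico` in `vis` with `Ioc` in the interval integral.
  have hVsub : V (stage z J (k + m)) ⊆
      ({0} ∪ bad) ∪ ⋃ w, (V (piece w) ∩ {φ | h φ < lam}) := by
    rintro φ ⟨hφ, x, ⟨hx, hxa⟩, hxφ⟩
    rcases lt_or_ge (h φ) lam with hl | hl
    · rw [hb, mem_iUnion] at hx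
      obtain ⟨w, hw⟩ := hx
      exact Or.inr (mem_iUnion.2 ⟨w, ⟨hφ, x, ⟨hw, hxa⟩, hxφ⟩, hl⟩)
    · rcases eq_or_lt_of_le hφ.1 with h0 | h0
      · exact Or.inl (Or.inl h0.symm)
      · exact Or.inl (Or.inr ⟨⟨h0, hφ.2.le⟩, hl⟩)
  have hbadtop : volume bad ≠ ⊤ :=
    ((measure_mono fun φ hφ => hφ.1).trans_lt measure_Ioc_lt_top).ne
  have hB0 : 0 ≤ B := by positivity
  have hVvol : volume.real (V (stage z J (k + m))) ≤ 2 * π * Fav S / lam + (s : ℝ) ^ k * B := by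
    have h1 : volume (V (stage z J (k + m))) ≤
        ENNReal.ofReal (2 * π * Fav S / lam + (s : ℝ) ^ k * B) := by
      refine (measure_mono hVsub).trans ((measure_union_le _ _).trans ?_)
      rw [ENNReal.ofReal_add (measureReal_nonneg.trans hbad) (by positivity)]
      refine add_le_add ((measure_union_le _ _).trans ?_) ((measure_iUnion_le _).trans ?_)
      · rw [Real.volume_singleton, zero_add, ← ENNReal.ofReal_toReal hbadtop]
        exact ENNReal.ofReal_le_ofReal hbad
      · rw [tsum_fintype]
        refine (Finset.sum_le_sum fun w _ => hgood w).trans ?_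
        rw [Finset.sum_const, Finset.card_univ, nsmul_eq_mul, Fintype.card_fun, Fintype.card_fin,
          Fintype.card_fin, Nat.cast_pow, ENNReal.ofReal_mul (p := (s : ℝ) ^ k) (by positivity),
          ENNReal.ofReal_pow hs0.le, ENNReal.ofReal_natCast]
    exact ENNReal.toReal_le_of_le_ofReal
      (add_nonneg (measureReal_nonneg.trans hbad) (by positivity)) h1
  have hsk : (s : ℝ) ^ k * ρ = 1 := by
    rw [hρdef, ← mul_pow, mul_one_div_cancel hs0.ne', one_pow]
  have hsm : (s : ℝ) ^ m * ρ ≤ (1 / (s : ℝ)) ^ m := by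
    have hs1 : 1 / (s : ℝ) ≤ 1 := by
      rw [div_le_one hs0]; exact_mod_cast (by omega : 1 ≤ s)
    have : ρ ≤ (1 / (s : ℝ)) ^ m * (1 / (s : ℝ)) ^ m := by
      rw [← pow_add, ← two_mul]
      exact pow_le_pow_of_le_one (by positivity) hs1 hkm
    calc (s : ℝ) ^ m * ρ ≤ (s : ℝ) ^ m * ((1 / (s : ℝ)) ^ m * (1 / (s : ℝ)) ^ m) := by gcongr
      _ = (1 / (s : ℝ)) ^ m := by
        rw [← mul_assoc, ← mul_pow, mul_one_div_cancel hs0.ne', one_pow, one_mul]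
  have hsB : (s : ℝ) ^ k * B ≤ 3 * (1 / d * (lam + 16 * R ^ 2 / d * (1 / (s : ℝ)) ^ m)) := by
    have e : (s : ℝ) ^ k * B =
        ((s : ℝ) ^ k * ρ) * (3 * (1 / d * (lam + 16 * R ^ 2 / d * ((s : ℝ) ^ m * ρ)))) := by
      rw [hB, hε]; ring
    rw [e, hsk, one_mul]
    gcongr
  set X := 1 / d * (lam + 16 * R ^ 2 / d * (1 / (s : ℝ)) ^ m)
  have hX : 0 ≤ X := by positivity
  have hπ := pi_gt_three
  change 1 / (2 * π) * volume.real (V (stage z J (k + m))) ≤ _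
  rw [one_div, inv_mul_le_iff₀ (by positivity)]
  refine (hVvol.trans (add_le_add_right hsB _)).trans ?_
  rw [mul_add, ← mul_div_assoc]
  refine add_le_add_right (mul_le_mul_of_nonneg_right ?_ hX) _
  linarith

theorem exists_vis_stage_le (hs : 2 ≤ s) (hJ : IsSelfSimilarSet z J) (hO : OpenSetCondition z)
    {F : Set Plane} (hF : IsCompact F) (hFJ : Disjoint F J) :
    ∃ C₁ > (0 : ℝ), ∃ C₂ > (0 : ℝ), ∀ a ∈ F, ∀ n : ℕ, 1 ≤ n →
      vis a (stage z J n) ≤ C₁ * √(Fav (stage z J ⌊C₂ * Real.log n⌋₊)) := by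
  have hs0 : (0 : ℝ) < s := by positivity
  have hs1 : 1 / (s : ℝ) < 1 := by
    rw [div_lt_one hs0]; exact_mod_cast (by omega : 1 < s)
  set q := 1 / (s : ℝ) with hq
  have hq0 : 0 < q := by positivity
  obtain ⟨R, hR0, hR⟩ := hJ.exists_norm_le
  obtain ⟨c, hc, hfav⟩ := exists_le_fav_stage hs hJ hO
  obtain ⟨d, hd, ha⟩ : ∃ d > 0, ∀ a ∈ F, ∀ x ∈ J, 2 * d ≤ dist a x := by
    obtain ⟨r, hr, h⟩ := Metric.exists_pos_forall_lt_edist hF hJ.isCompact.isClosed hFJ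
    refine ⟨r / 2, by positivity, fun a ha x hx => ?_⟩
    have := h a ha x hx
    rw [edist_nndist, ENNReal.coe_lt_coe] at this
    rw [dist_nndist, mul_div_cancel₀ _ two_ne_zero]
    exact_mod_cast this.le
  -- From generation `K` on, copies are small compared with their distance from `F`. `C` handles `n
  -- < 2 * K`, where `vis ≤ 1` suffices; `C'` handles the rest.
  obtain ⟨K, hK⟩ : ∃ K : ℕ, q ^ K < d / (4 * R) :=
    exists_pow_lt_of_lt_one (by positivity) hs1
  set C := 1 / √(c * q ^ (2 * K)) with hC
  have hC0 : 0 < C := by positivity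
  set C' := 1 + 1 / d * (1 + 16 * R ^ 2 / d * (1 / √c)) with hC'
  have hC'0 : 0 < C' := by positivity
  refine ⟨C + C', by positivity, 1 / 3, by norm_num, fun a haF n hn => ?_⟩
  set m := ⌊1 / 3 * Real.log n⌋₊ with hm
  -- This is all that is used of the logarithm: it gives `k = n - m ≥ 2 * m`, and `k ≥ K` once `n ≥
  -- 2 * K`.
  have hmn : 3 * m ≤ n := by
    have h1 : (m : ℝ) ≤ 1 / 3 * Real.log n :=
      Nat.floor_le (mul_nonneg (by norm_num) (Real.log_natCast_nonneg n))
    have h2 : Real.log n ≤ n := Real.log_le_self (by positivity)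
    have : ((3 * m : ℕ) : ℝ) ≤ n := by push_cast; linarith
    exact_mod_cast this
  have hF0 : 0 < Fav (stage z J m) := lt_of_lt_of_le (by positivity) (hfav m)
  set lam := √(Fav (stage z J m)) with hlam
  have hlam0 : 0 < lam := Real.sqrt_pos.2 hF0
  rcases lt_or_ge n (2 * K) with hnK | hnK
  · refine (vis_le_one _ _).trans ?_
    have h1 : √(c * q ^ (2 * K)) ≤ lam := by
      apply Real.sqrt_le_sqrt
      refine le_trans ?_ (hfav m)
      exact mul_le_mul_of_nonneg_left
        (pow_le_pow_of_le_one hq0.le hs1.le (by omega)) hc.le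
    have h2 : 1 ≤ C * lam := by
      rw [hC, one_div_mul_eq_div, one_le_div (by positivity)]
      exact h1
    nlinarith [mul_pos hC'0 hlam0]
  · obtain ⟨k, hnk⟩ : ∃ k, n = k + m := ⟨n - m, by omega⟩
    have hkK : q ^ k ≤ q ^ K := pow_le_pow_of_le_one hq0.le hs1.le (by omega)
    have hk : 4 * (q ^ k * R) ≤ d := by
      have := (lt_div_iff₀ (by positivity)).1 hK
      nlinarith
    rw [hnk]
    refine (vis_stage_add_le hs hJ hd hlam0 hR (ha a haF) hk (by omega)).trans ?_
    have e1 : Fav (stage z J m) / lam = lam := Real.div_sqrt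
    have e2 : q ^ m ≤ 1 / √c * lam := by
      rw [one_div_mul_eq_div, le_div_iff₀ (by positivity), hlam]
      apply Real.le_sqrt_of_sq_le
      refine le_trans ?_ (hfav m)
      rw [mul_pow, Real.sq_sqrt hc.le, mul_comm]
      have : q ^ m ≤ 1 := pow_le_one₀ hq0.le hs1.le
      have h0 : 0 < q ^ m := by positivity
      refine mul_le_mul_of_nonneg_left ?_ hc.le
      nlinarith
    rw [e1]
    calc lam + 1 / d * (lam + 16 * R ^ 2 / d * q ^ m)
        ≤ lam + 1 / d * (lam + 16 * R ^ 2 / d * (1 / √c * lam)) := by gcongr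
      _ = C' * lam := by rw [hC']; ring
      _ ≤ (C + C') * lam := by
        refine mul_le_mul_of_nonneg_right ?_ hlam0.le
        linarith

end Visibility

theorem mainTheorem2 (s : ℕ) (hs : 2 ≤ s) (z : Fin s → Visibility.Plane)
    (J : Set Visibility.Plane) (hJ : Visibility.IsSelfSimilarSet z J)
    (hO : Visibility.OpenSetCondition z) :
    (∀ a : Visibility.Plane, a ∉ J → ∃ C₁ > (0 : ℝ), ∃ C₂ > (0 : ℝ), ∀ n : ℕ, 1 ≤ n →
      Visibility.vis a (Visibility.stage z J n) ≤
        C₁ * √(Visibility.Fav (Visibility.stage z J ⌊C₂ * Real.log n⌋₊))) ∧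
    (∀ F : Set Visibility.Plane, IsCompact F → Disjoint F J →
      ∃ C₁ > (0 : ℝ), ∃ C₂ > (0 : ℝ), ∀ a ∈ F, ∀ n : ℕ, 1 ≤ n →
        Visibility.vis a (Visibility.stage z J n) ≤
          C₁ * √(Visibility.Fav (Visibility.stage z J ⌊C₂ * Real.log n⌋₊))) := by
  have main : ∀ F : Set Visibility.Plane, IsCompact F → Disjoint F J →
      ∃ C₁ > (0 : ℝ), ∃ C₂ > (0 : ℝ), ∀ a ∈ F, ∀ n : ℕ, 1 ≤ n →
        Visibility.vis a (Visibility.stage z J n) ≤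
          C₁ * √(Visibility.Fav (Visibility.stage z J ⌊C₂ * Real.log n⌋₊)) :=
    fun F hF hFJ => Visibility.exists_vis_stage_le hs hJ hO hF hFJ
  refine ⟨fun a ha => ?_, main⟩
  obtain ⟨C₁, hC₁, C₂, hC₂, h⟩ := main {a} isCompact_singleton (disjoint_singleton_left.2 ha)
  exact ⟨C₁, hC₁, C₂, hC₂, h a rfl⟩
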